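/- Consider a single-server first-come first-served queue. Potential customers arrive according to a Poisson process with rate $\lambda>0$. Service requirements are i.i.d. exponential with mean $1$. The server works at rate $\mu_k$ while $k$ customers are present, where $(\mu_k)_{k\ge 0}$ is non-decreasing and $\mu_1>0$. A joining strategy is a sequence $p=(p_k)_{k\ge0}$ in $[0,1]$; an arriving customer who finds $k$ customers present joins with probability $p_k$, independently of everything else. The pure threshold strategy $\tilde p(n_0)$, $n_0\in\{1,2,\dots\}$, has $p_k=1$ for $k<n_0$ and $p_k=0$ for $k\ge n_0$. The mixed threshold strategy $\hat p(x)$, $x>0$ real, has $p_k=1$ for $k<\lfloor x\rfloor$, $p_{\lfloor x\rfloor}=x-\lfloor x\rfloor$, and $p_k=0$ for $k>\lfloor x\rfloor$. Write $n_0(p)=\min\{k: p_k=0\}$. For $n<m$ let $W(n,m;p)$ be the expected remaining time in the system of a customer who has $n$ customers in front of her when there are $m$ customers in total and all future arrivals follow $p$. For $0\le n\le n_0(p)$ let $W(n;p)$ be the expected sojourn time of a customer who joins on finding $n$ customers, that is, $W(n;p)=W(n,n+1;p)$ for $n<n_0(p)$ and $W(n_0(p);p)=\frac1{\mu_{n_0(p)+1}}+W(n_0(p)-1,n_0(p);p)$.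 Let $p$ be a pure or a mixed threshold strategy and let $n\ge 1$. Couple two such queues on one probability space: at time $0$ system $A$ holds customers $1,\dots,n$, with customer $1$ entering service, and system $B$ holds customers $0,1,\dots,n$, with customer $0$ entering service. The two systems share the service requirements $S_1,\dots,S_n$ of customers $1,\dots,n$, the arrival times of all future potential customers, and, for each of these, the random variable that settles a randomized join decision. Let $T_A(j)$ and $T_B(j)$ be the departure times of customer $j$ from $A$ and from $B$. Then the following hold. 1. Almost surely, $T_A(j)\le T_B(j)$ for all $j=1,\dots,n$. 2. $T_A(n)$ and $T_B(n)$ are integrable, with $E[T_A(n)]=W(n-1,n;p)$ and $E[T_B(n)]=W(n,n+1;p)$. Hence $W(n-1,n;p)\le W(n,n+1;p)$ for every $n\ge1$. 3. $W(n;p)$ is non-decreasing in $n$ for $0\le n\le n_0(p)$. -/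

import Mathlib

open MeasureTheory ProbabilityTheory

noncomputable section

namespace ThresholdQueue

/-! ### Joining strategies

A strategy is a sequence `p`, where `p n` is the probability that a customer who finds `n`
customers in the system joins it. -/

/-- The pure threshold strategy with threshold `n₀`: join if and only if fewer than `n₀` customers
are present. -/
def pureThreshold (n₀ : ℕ) : ℕ → ℝ := fun n => if n < n₀ then 1 else 0

/-- The mixed threshold strategy with parameter `x`: join below `⌊x⌋`, join with probability
`x - ⌊x⌋` at `⌊x⌋`, balk above `⌊x⌋`. -/
def mixedThreshold (x : ℝ) : ℕ → ℝ := fun n =>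
  if n < ⌊x⌋₊ then 1 else if n = ⌊x⌋₊ then x - (⌊x⌋₊ : ℝ) else 0

/-- Threshold strategies, pure (positive integer threshold) or mixed (positive real parameter). -/
def IsThresholdStrategy (p : ℕ → ℝ) : Prop :=
  (∃ n₀ : ℕ, 1 ≤ n₀ ∧ p = pureThreshold n₀) ∨ (∃ x : ℝ, 0 < x ∧ p = mixedThreshold x)

/-- The first state at which the strategy prescribes balking. -/
def balkState (p : ℕ → ℝ) : ℕ := sInf {n | p n = 0}

/-! ### Sample paths of the first-come first-served single server queue

The server works at rate `μ k` while `k` customers are present. The data of a sample path are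
* `gap k`: time between potential arrivals `k - 1` and `k` (`gap 0`: from time `0` to arrival `0`);
* `req i`: service requirement of the customer who is served `i`-th (counting from `0`);
* `mark k`: number that settles the decision of arrival `k`, who joins when finding `n` customers
  if and only if `mark k < p n`. -/

/-- State of the queue just after an event (an arrival or a service completion). -/
structure State where
  /-- time of the event -/
  time : ℝ
  /-- number of customers present -/
  num : ℕ
  /-- remaining requirement of the customer in service (or of the next one, if `num = 0`) -/
  rem : ℝ
  /-- number of departures so far -/
  dep : ℕ
  /-- number of potential arrivals so far -/
  arr : ℕ

/-- Time of potential arrival `k`. -/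
def arrivalTime (gap : ℕ → ℝ) (k : ℕ) : ℝ := ∑ i ∈ Finset.range (k + 1), gap i

open Classical in
/-- Passage to the next event. It is a service completion if somebody is present and the remaining
requirement, worked off at the present rate, is exhausted before the next arrival; otherwise it is
the next arrival. -/
def step (μ p gap req mark : ℕ → ℝ) (σ : State) : State :=
  if 0 < σ.num ∧ σ.time + σ.rem / μ σ.num ≤ arrivalTime gap σ.arr then
    { time := σ.time + σ.rem / μ σ.num
      num := σ.num - 1
      rem := req (σ.dep + 1)
      dep := σ.dep + 1
      arr := σ.arr }
  else
    { time := arrivalTime gap σ.arr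
      num := if mark σ.arr < p σ.num then σ.num + 1 else σ.num
      rem := if 0 < σ.num then σ.rem - μ σ.num * (arrivalTime gap σ.arr - σ.time) else σ.rem
      dep := σ.dep
      arr := σ.arr + 1 }

/-- The state after `k` events, when at time `0` there are `m` customers and the first of them
just enters service. -/
def path (μ p : ℕ → ℝ) (m : ℕ) (gap req mark : ℕ → ℝ) (k : ℕ) : State :=
  (step μ p gap req mark)^[k] { time := 0, num := m, rem := req 0, dep := 0, arr := 0 }

/-- The departure time of the customer who is served `i`-th (counting from `0`): the time of the
first event after which more than `i` customers have departed. -/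
def departureTime (μ p : ℕ → ℝ) (m : ℕ) (gap req mark : ℕ → ℝ) (i : ℕ) : ℝ :=
  (path μ p m gap req mark (sInf {k | i < (path μ p m gap req mark k).dep})).time

/-! ### Randomness -/

/-- Index set of the random variables that drive the queue. -/
inductive Source where
  | gap (k : ℕ)
  | req (k : ℕ)
  | mark (k : ℕ)

/-- Interarrival times are exponential with rate `lam` (Poisson arrivals), service requirements are
exponential with mean `1`, marks are uniform on `[0, 1]`. -/
def sourceLaw (lam : ℝ) : Source → Measure ℝ
  | .gap _ => expMeasure lam
  | .req _ => expMeasure 1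
  | .mark _ => volume.restrict (Set.Icc 0 1)

/-- The family `ξ` of random variables on `(Ω, P)` is independent and has the required laws. -/
structure IsDriving {Ω : Type*} [MeasurableSpace Ω] (lam : ℝ) (ξ : Source → Ω → ℝ)
    (P : Measure Ω) : Prop where
  indep : iIndepFun ξ P
  law : ∀ s, HasLaw (ξ s) (sourceLaw lam s) P

/-- `W(n, m; p)` for `n < m`: the expected time until departure of a customer who has `n` customers
in front of her, when `m` customers in total are in the system and all future arrivals follow the
strategy `p`. -/
def genWait (lam : ℝ) (μ p : ℕ → ℝ) (n m : ℕ) : ℝ :=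
  ∫ ω : Source → ℝ,
    departureTime μ p m (fun k => ω (.gap k)) (fun k => ω (.req k)) (fun k => ω (.mark k)) n
    ∂(Measure.infinitePi (sourceLaw lam))

/-- `W(n; p)` for `n ≤ n₀`, where `n₀ = balkState p`: the expected sojourn time of a customer who
joins when finding `n` customers. At `n = n₀` all arrivals balk until the next departure. -/
def delay (lam : ℝ) (μ p : ℕ → ℝ) (n : ℕ) : ℝ :=
  if n < balkState p then genWait lam μ p n (n + 1)
  else 1 / μ (balkState p + 1) + genWait lam μ p (balkState p - 1) (balkState p)

/-- `T_A(j)`, `j = 1, …, n`, in the coupled system `A`, which starts with the `n` customers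
`1, …, n`; customer `j` has requirement `ξ (.req j)`. -/
def sojournA {Ω : Type*} (μ p : ℕ → ℝ) (n : ℕ) (ξ : Source → Ω → ℝ) (j : ℕ) (ω : Ω) : ℝ :=
  departureTime μ p n (fun k => ξ (.gap k) ω) (fun k => ξ (.req (k + 1)) ω)
    (fun k => ξ (.mark k) ω) (j - 1)

/-- `T_B(j)`, `j = 0, …, n`, in the coupled system `B`, which starts with the `n + 1` customers
`0, …, n`; customer `j` has requirement `ξ (.req j)`, and arrivals (with their marks) are those of
system `A`. -/
def sojournB {Ω : Type*} (μ p : ℕ → ℝ) (n : ℕ) (ξ : Source → Ω → ℝ) (j : ℕ) (ω : Ω) : ℝ :=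
  departureTime μ p (n + 1) (fun k => ξ (.gap k) ω) (fun k => ξ (.req k) ω)
    (fun k => ξ (.mark k) ω) j

end ThresholdQueue

end

namespace ThresholdQueue

/-! ### Invariants of a single sample path. -/

section Deterministic

variable {μ p gap req mark : ℕ → ℝ}

lemma step_of_completion {σ : State}
    (h : 0 < σ.num ∧ σ.time + σ.rem / μ σ.num ≤ arrivalTime gap σ.arr) :
    step μ p gap req mark σ =
      { time := σ.time + σ.rem / μ σ.num
        num := σ.num - 1
        rem := req (σ.dep + 1)
        dep := σ.dep + 1
        arr := σ.arr } := by
  rw [step, if_pos h]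

lemma step_of_arrival {σ : State}
    (h : ¬(0 < σ.num ∧ σ.time + σ.rem / μ σ.num ≤ arrivalTime gap σ.arr)) :
    step μ p gap req mark σ =
      { time := arrivalTime gap σ.arr
        num := open Classical in if mark σ.arr < p σ.num then σ.num + 1 else σ.num
        rem := if 0 < σ.num then σ.rem - μ σ.num * (arrivalTime gap σ.arr - σ.time) else σ.rem
        dep := σ.dep
        arr := σ.arr + 1 } := by
  rw [step, if_neg h]

lemma path_zero (m : ℕ) : path μ p m gap req mark 0 =
    { time := 0, num := m, rem := req 0, dep := 0, arr := 0 } := rfl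

lemma path_succ (m k : ℕ) :
    path μ p m gap req mark (k + 1) = step μ p gap req mark (path μ p m gap req mark k) := by
  simp only [path, Function.iterate_succ_apply']

/-- The properties shared by all states that occur, after `k` events, on a sample path which
starts with `m` customers. -/
structure IsReached (μ gap req : ℕ → ℝ) (m k : ℕ) (σ : State) : Prop where
  rem_nonneg : 0 ≤ σ.rem
  rem_le : σ.rem ≤ req σ.dep
  time_nonneg : 0 ≤ σ.time
  time_le : σ.time ≤ arrivalTime gap σ.arr
  le_time : ∀ a, σ.arr = a + 1 → arrivalTime gap a ≤ σ.time
  le_num : m ≤ σ.num + σ.dep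
  count : σ.dep + σ.arr = k
  work : σ.dep < m → μ 1 * σ.time + σ.rem ≤ ∑ i ∈ Finset.range (σ.dep + 1), req i

lemma rate_pos (hμ : Monotone μ) (hμ1 : 0 < μ 1) {k : ℕ} (hk : 0 < k) : 0 < μ k :=
  hμ1.trans_le (hμ hk)

lemma arrivalTime_le_succ (hgap : ∀ k, 0 ≤ gap k) (k : ℕ) :
    arrivalTime gap k ≤ arrivalTime gap (k + 1) := by
  rw [arrivalTime, arrivalTime, Finset.sum_range_succ _ (k + 1)]
  linarith [hgap (k + 1)]

/-- The `work` bound survives because the server is never idle while an initial customer remains,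
and then works at rate at least `μ 1`. -/
lemma IsReached.step (hμ : Monotone μ) (hμ1 : 0 < μ 1) (hgap : ∀ k, 0 ≤ gap k)
    (hreq : ∀ k, 0 ≤ req k) {m k : ℕ} {σ : State} (h : IsReached μ gap req m k σ) :
    IsReached μ gap req m (k + 1) (step μ p gap req mark σ) := by
  obtain ⟨h1, h2, h3, h4, h5, h6, h7, h8⟩ := h
  by_cases hc : 0 < σ.num ∧ σ.time + σ.rem / μ σ.num ≤ arrivalTime gap σ.arr
  · rw [step_of_completion hc]
    have hpos := rate_pos hμ hμ1 hc.1
    have hq : 0 ≤ σ.rem / μ σ.num := div_nonneg h1 hpos.le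
    refine ⟨hreq _, le_rfl, by simp only; linarith, hc.2,
      fun a ha => (h5 a ha).trans (by simp only; linarith), by simp only; omega,
      by simp only; omega, fun hd => ?_⟩
    have hw := h8 (by simp only at hd; omega)
    have h9 : μ 1 * (σ.rem / μ σ.num) ≤ σ.rem := by
      calc μ 1 * (σ.rem / μ σ.num) ≤ μ σ.num * (σ.rem / μ σ.num) :=
            mul_le_mul_of_nonneg_right (hμ hc.1) hq
        _ = σ.rem := by field_simp
    rw [Finset.sum_range_succ]
    simp only
    linarith
  · rw [step_of_arrival hc]
    have hnum : σ.num ≤ (open Classical in if mark σ.arr < p σ.num then σ.num + 1 else σ.num) := by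
      split_ifs <;> omega
    by_cases hn : 0 < σ.num
    · have hpos := rate_pos hμ hμ1 hn
      have hlt : arrivalTime gap σ.arr - σ.time < σ.rem / μ σ.num := by
        have := not_le.1 fun hle => hc ⟨hn, hle⟩
        linarith
      rw [lt_div_iff₀ hpos] at hlt
      have hwork : μ 1 * (arrivalTime gap σ.arr - σ.time) ≤
          μ σ.num * (arrivalTime gap σ.arr - σ.time) :=
        mul_le_mul_of_nonneg_right (hμ hn) (by linarith)
      have hnn : 0 ≤ μ 1 * (arrivalTime gap σ.arr - σ.time) :=
        mul_nonneg hμ1.le (by linarith)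
      simp only [if_pos hn]
      refine ⟨by simp only; linarith, by simp only; linarith, h3.trans h4,
        arrivalTime_le_succ hgap _, fun a ha => ?_, by simp only; omega, by simp only; omega,
        fun hd => ?_⟩
      · obtain rfl : σ.arr = a := by simpa using ha
        exact le_rfl
      · have := h8 hd
        simp only
        linarith
    · simp only [if_neg hn]
      refine ⟨h1, h2, h3.trans h4, arrivalTime_le_succ hgap _, fun a ha => ?_,
        by simp only; omega, by simp only; omega, fun hd => ?_⟩
      · obtain rfl : σ.arr = a := by simpa using ha
        exact le_rfl
      -- An empty system contradicts `le_num` while fewer than `m` customers have left.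
      · simp only at hd
        omega

lemma isReached_path (hμ : Monotone μ) (hμ1 : 0 < μ 1) (hgap : ∀ k, 0 ≤ gap k)
    (hreq : ∀ k, 0 ≤ req k) (m k : ℕ) :
    IsReached μ gap req m k (path μ p m gap req mark k) := by
  induction k with
  | zero =>
    rw [path_zero]
    exact ⟨hreq 0, le_rfl, le_rfl, by simpa [arrivalTime] using hgap 0, by simp, by simp, rfl,
      by simp⟩
  | succ k ih => rw [path_succ]; exact ih.step hμ hμ1 hgap hreq

lemma IsReached.time_le_step (hμ : Monotone μ) (hμ1 : 0 < μ 1) {m k : ℕ} {σ : State}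
    (h : IsReached μ gap req m k σ) : σ.time ≤ (ThresholdQueue.step μ p gap req mark σ).time := by
  by_cases hc : 0 < σ.num ∧ σ.time + σ.rem / μ σ.num ≤ arrivalTime gap σ.arr
  · rw [step_of_completion hc]
    exact le_add_of_nonneg_right (div_nonneg h.rem_nonneg (rate_pos hμ hμ1 hc.1).le)
  · rw [step_of_arrival hc]
    exact h.time_le

lemma monotone_path_time (hμ : Monotone μ) (hμ1 : 0 < μ 1) (hgap : ∀ k, 0 ≤ gap k)
    (hreq : ∀ k, 0 ≤ req k) (m : ℕ) : Monotone fun k => (path μ p m gap req mark k).time :=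
  monotone_nat_of_le_succ fun k => by
    rw [path_succ]
    exact (isReached_path hμ hμ1 hgap hreq m k).time_le_step hμ hμ1

lemma dep_le_step (σ : State) : σ.dep ≤ (step μ p gap req mark σ).dep := by
  by_cases hc : 0 < σ.num ∧ σ.time + σ.rem / μ σ.num ≤ arrivalTime gap σ.arr
  · simp [step_of_completion hc]
  · simp [step_of_arrival hc]

lemma monotone_path_dep (m : ℕ) : Monotone fun k => (path μ p m gap req mark k).dep :=
  monotone_nat_of_le_succ fun k => by rw [path_succ]; exact dep_le_step _

/-- An initial customer leaves as soon as the work in front of her and her own are done, so at the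
minimal rate `μ 1` at the latest. -/
lemma departureTime_mem_Icc (hμ : Monotone μ) (hμ1 : 0 < μ 1) (hgap : ∀ k, 0 ≤ gap k)
    (hreq : ∀ k, 0 ≤ req k) {m i : ℕ} (hi : i < m) :
    departureTime μ p m gap req mark i ∈
      Set.Icc 0 ((∑ j ∈ Finset.range (i + 1), req j) / μ 1) := by
  refine ⟨(isReached_path hμ hμ1 hgap hreq m _).time_nonneg, ?_⟩
  rw [departureTime, le_div_iff₀ hμ1]
  have hsum : 0 ≤ ∑ j ∈ Finset.range (i + 1), req j := Finset.sum_nonneg fun j _ => hreq j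
  -- Index `0` arises only as the default infimum of the empty set; the time is then `0` and the
  -- bound still holds.
  rcases Nat.eq_zero_or_pos (sInf {k | i < (path μ p m gap req mark k).dep}) with h0 | h0
  · rw [h0, path_zero]
    simpa using hsum
  · obtain ⟨k, hk⟩ := Nat.exists_eq_succ_of_ne_zero h0.ne'
    have hmem := Nat.sInf_mem (Nat.nonempty_of_pos_sInf h0)
    have hnot : k ∉ {k | i < (path μ p m gap req mark k).dep} :=
      Nat.notMem_of_lt_sInf (by omega)
    rw [hk] at hmem ⊢
    simp only [Set.mem_ofPred_eq, not_lt] at hmem hnot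
    rw [Nat.succ_eq_add_one, path_succ] at hmem ⊢
    have hr := isReached_path (p := p) (mark := mark) hμ hμ1 hgap hreq m k
    generalize path μ p m gap req mark k = σ at *
    by_cases hc : 0 < σ.num ∧ σ.time + σ.rem / μ σ.num ≤ arrivalTime gap σ.arr
    · rw [step_of_completion hc] at hmem ⊢
      obtain rfl : i = σ.dep := by simp only at hmem; omega
      have hpos := rate_pos hμ hμ1 hc.1
      have h9 : σ.rem / μ σ.num * μ 1 ≤ σ.rem := by
        calc σ.rem / μ σ.num * μ 1 ≤ σ.rem / μ σ.num * μ σ.num :=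
              mul_le_mul_of_nonneg_left (hμ hc.1) (div_nonneg hr.rem_nonneg hpos.le)
          _ = σ.rem := by field_simp
      have := hr.work hi
      simp only
      linarith
    · rw [step_of_arrival hc] at hmem
      simp only at hmem
      omega

/-- If the arrival times are unbounded, then all initial customers depart. -/
lemma exists_lt_dep (hμ : Monotone μ) (hμ1 : 0 < μ 1) (hgap : ∀ k, 0 ≤ gap k)
    (hreq : ∀ k, 0 ≤ req k) (harr : ∀ C, ∃ k, C < arrivalTime gap k) {m i : ℕ} (hi : i < m) :
    ∃ k, i < (path μ p m gap req mark k).dep := by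
  by_contra! hall
  obtain ⟨a, ha⟩ := harr ((∑ j ∈ Finset.range (i + 1), req j) / μ 1)
  rw [div_lt_iff₀ hμ1] at ha
  -- Among `i + a + 1` events with at most `i` departures there are at least `a + 1` arrivals, so
  -- the clock has passed arrival `a` and the work bound fails.
  have hr := isReached_path (p := p) (mark := mark) hμ hμ1 hgap hreq m (i + a + 1)
  have hd := hall (i + a + 1)
  generalize path μ p m gap req mark (i + a + 1) = σ at *
  have hmono : Monotone (arrivalTime gap) := monotone_nat_of_le_succ (arrivalTime_le_succ hgap)
  have hc := hr.count
  have h1 : arrivalTime gap a ≤ σ.time :=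
    (hmono (by omega)).trans (hr.le_time (σ.arr - 1) (by omega))
  have h2 := hr.work (by omega)
  have h3 : ∑ j ∈ Finset.range (σ.dep + 1), req j ≤ ∑ j ∈ Finset.range (i + 1), req j :=
    Finset.sum_le_sum_of_subset_of_nonneg (Finset.range_mono (by omega)) fun j _ _ => hreq j
  have h4 := mul_le_mul_of_nonneg_left h1 hμ1.le
  linarith [hr.rem_nonneg]

/-! ### Pathwise comparison of the two systems. -/

/-- The relation kept by two systems of which the first starts with customers `1, …, n` and the
second with customers `0, …, n`, when both are observed at time `t`, with no event between their
last ones and `t`: the first system has done at least as much of the work of customers `1, …, n`,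
and has admitted at least as many arrivals. -/
structure Ahead (μ gap : ℕ → ℝ) (σ τ : State) (t : ℝ) : Prop where
  arr_eq : σ.arr = τ.arr
  left_le : σ.time ≤ t
  right_le : τ.time ≤ t
  le_arrival : t ≤ arrivalTime gap σ.arr
  le_left : t ≤ σ.time + σ.rem / μ σ.num
  le_right : t ≤ τ.time + τ.rem / μ τ.num
  dep_le : τ.dep ≤ σ.dep + 1
  rem_le : τ.dep = σ.dep + 1 →
    σ.rem - μ σ.num * (t - σ.time) ≤ τ.rem - μ τ.num * (t - τ.time)
  joined_le : τ.num + τ.dep ≤ σ.num + σ.dep + 1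

/-- With the same customer in service, `joined_le` reduces to `τ.num ≤ σ.num`, so the first system's
rate is at least the second's. -/
lemma Ahead.rem_le_of_le (hμ : Monotone μ) {σ τ : State} {t : ℝ} (h : Ahead μ gap σ τ t)
    (hd : τ.dep = σ.dep + 1) {u : ℝ} (hu : t ≤ u) :
    σ.rem - μ σ.num * (u - σ.time) ≤ τ.rem - μ τ.num * (u - τ.time) := by
  have h1 := h.rem_le hd
  have h2 := h.joined_le
  have h3 : μ τ.num * (u - t) ≤ μ σ.num * (u - t) :=
    mul_le_mul_of_nonneg_right (hμ (by omega)) (by linarith)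
  linarith

/-- The first system stays ahead after the next event. -/
lemma Ahead.next (hμ : Monotone μ) (hμ1 : 0 < μ 1) (hp : Antitone p) (hgap : ∀ k, 0 ≤ gap k)
    (hreq : ∀ k, 0 ≤ req k) {n k l : ℕ} {σ τ : State} {t : ℝ} (h : Ahead μ gap σ τ t)
    (hσ : IsReached μ gap (fun k => req (k + 1)) n k σ) (hτ : IsReached μ gap req (n + 1) l τ)
    (hσn : σ.dep < n) :
    let σ' := step μ p gap (fun k => req (k + 1)) mark σ
    let τ' := step μ p gap req mark τ
    (σ'.dep = σ.dep + 1 ∧ σ'.time ≤ τ'.time ∧ (σ'.dep < n → Ahead μ gap σ' τ σ'.time)) ∨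
      (Ahead μ gap σ τ' τ'.time) ∨ (σ'.dep = σ.dep ∧ Ahead μ gap σ' τ' τ'.time) := by
  intro σ' τ'
  have hσ' : IsReached μ gap (fun k => req (k + 1)) n (k + 1) σ' :=
    hσ.step hμ hμ1 hgap fun k => hreq (k + 1)
  have hτ' : IsReached μ gap req (n + 1) (l + 1) τ' := hτ.step hμ hμ1 hgap hreq
  have hσnum : 0 < σ.num := by have := hσ.le_num; omega
  have hτnum : 0 < τ.num := by have := hτ.le_num; have := h.dep_le; omega
  have hσpos := rate_pos hμ hμ1 hσnum
  have hτpos := rate_pos hμ hμ1 hτnum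
  have harr := h.arr_eq
  have hdep := h.dep_le
  have hjoin := h.joined_le
  have hσn' := hσ.le_num
  have hτn' := hτ.le_num
  -- The earliest pending event is processed; a tie between completions goes to the first system.
  by_cases hA : 0 < σ.num ∧ σ.time + σ.rem / μ σ.num ≤ arrivalTime gap σ.arr ∧
      σ.time + σ.rem / μ σ.num ≤ τ.time + τ.rem / μ τ.num
  · left
    have hσe : σ' = _ := step_of_completion ⟨hA.1, hA.2.1⟩
    have hτe : σ.time + σ.rem / μ σ.num ≤ τ'.time := by
      by_cases hc : 0 < τ.num ∧ τ.time + τ.rem / μ τ.num ≤ arrivalTime gap τ.arr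
      · rw [show τ' = _ from step_of_completion hc]
        exact hA.2.2
      · rw [show τ' = _ from step_of_arrival hc]
        simpa [← harr] using hA.2.1
    rw [hσe]
    refine ⟨rfl, hτe, fun hlt => ?_⟩
    simp only at hlt
    have hpos' : 0 < μ (σ.num - 1) := rate_pos hμ hμ1 (by omega)
    exact ⟨harr, le_rfl, h.right_le.trans h.le_left, hA.2.1,
      le_add_of_nonneg_right (div_nonneg (hreq _) hpos'.le), hA.2.2,
      by simp only; omega, fun he => by simp only at he; omega, by simp only; omega⟩
  · right
    by_cases hB : 0 < τ.num ∧ τ.time + τ.rem / μ τ.num ≤ arrivalTime gap τ.arr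
    · left
      have hlt : τ.time + τ.rem / μ τ.num < σ.time + σ.rem / μ σ.num := by
        by_contra! hle
        exact hA ⟨hσnum, hle.trans (harr ▸ hB.2), hle⟩
      -- Otherwise both serve the same customer, and the first system would finish her no later.
      have hne : τ.dep ≠ σ.dep + 1 := by
        intro he
        have h1 := h.rem_le_of_le hμ he h.le_right
        have h2 : μ τ.num * (τ.time + τ.rem / μ τ.num - τ.time) = τ.rem := by
          field_simp; ring
        have h3 : τ.time + τ.rem / μ τ.num - σ.time < σ.rem / μ σ.num := by linarith
        rw [lt_div_iff₀ hσpos] at h3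
        linarith
      have hτe : τ' = _ := step_of_completion hB
      have hle : σ.time ≤ τ.time + τ.rem / μ τ.num := h.left_le.trans h.le_right
      have hnn : 0 ≤ μ σ.num * (τ.time + τ.rem / μ τ.num - σ.time) :=
        mul_nonneg hσpos.le (by linarith)
      rw [hτe]
      have hpos' : 0 < μ (τ.num - 1) := rate_pos hμ hμ1 (by omega)
      refine ⟨harr, hle, le_rfl, harr ▸ hB.2, hlt.le,
        le_add_of_nonneg_right (div_nonneg (hreq _) hpos'.le), by simp only; omega,
        fun he => ?_, by simp only; omega⟩
      simp only at he ⊢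
      -- The second system has just begun a customer whom the first is already serving, so her full
      -- requirement bounds what remains in the first.
      have := hσ.rem_le
      rw [he]
      linarith
    · right
      have hltτ : arrivalTime gap τ.arr < τ.time + τ.rem / μ τ.num :=
        not_le.1 fun hle => hB ⟨hτnum, hle⟩
      have hltσ : arrivalTime gap σ.arr < σ.time + σ.rem / μ σ.num := by
        by_contra! hle
        exact hA ⟨hσnum, hle, hle.trans (harr ▸ hltτ.le)⟩
      have hσe : σ' = _ := step_of_arrival fun hc => hltσ.not_ge hc.2
      have hτe : τ' = _ := step_of_arrival hB
      have hσr := hσ'.rem_nonneg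
      have hτr := hτ'.rem_nonneg
      have hσnum' := hσ'.le_num
      have hτnum' := hτ'.le_num
      rw [hσe] at hσr hσnum' ⊢
      rw [hτe] at hτr hτnum' ⊢
      simp only [if_pos hσnum, if_pos hτnum] at hσr hτr hσnum' hτnum' ⊢
      refine ⟨trivial, ?_, ?_, le_rfl, ?_, ?_, ?_, hdep, fun he => ?_, ?_⟩
      · simp only [harr]
      · simp only [harr, le_rfl]
      · simp only [← harr]
        exact arrivalTime_le_succ hgap _
      · simp only [← harr]
        exact le_add_of_nonneg_right (div_nonneg hσr (rate_pos hμ hμ1 (by split_ifs <;> omega)).le)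
      · refine le_add_of_nonneg_right (div_nonneg hτr (rate_pos hμ hμ1 ?_).le)
        simp only
        split_ifs <;> omega
      · have := h.rem_le_of_le hμ he h.le_arrival
        simpa [← harr] using this
      · simp only [← harr]
        -- If the first system is no longer, its joining probability is no smaller and the mark is
        -- shared. If it is longer, `dep_le` makes `joined_le` strict, leaving room for a lone
        -- admission in the second.
        rcases le_or_gt σ.num τ.num with hle | hgt
        · have := hp hle
          split_ifs <;> first | omega | (exfalso; linarith)
        · split_ifs <;> omega

/-- If the departure in the first system came too late, `Ahead` could be propagated through
arbitrarily many events before it, whereas only boundedly many fit. -/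
lemma exists_dep_time_le (hμ : Monotone μ) (hμ1 : 0 < μ 1) (hp : Antitone p)
    (hgap : ∀ k, 0 ≤ gap k) (hreq : ∀ k, 0 ≤ req k) {n j K : ℕ} (hjn : j < n)
    (hK : j + 1 < (path μ p (n + 1) gap req mark K).dep) :
    ∃ k, j < (path μ p n gap (fun k => req (k + 1)) mark k).dep ∧
      (path μ p n gap (fun k => req (k + 1)) mark k).time ≤
        (path μ p (n + 1) gap req mark K).time := by
  by_contra! hcon
  have key : ∀ N : ℕ, ∃ k l t, N ≤ k + l ∧
      (path μ p n gap (fun k => req (k + 1)) mark k).dep ≤ j ∧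
      Ahead μ gap (path μ p n gap (fun k => req (k + 1)) mark k)
        (path μ p (n + 1) gap req mark l) t := by
    intro N
    induction N with
    | zero =>
      refine ⟨0, 0, 0, le_rfl, Nat.zero_le _, ?_⟩
      rw [path_zero, path_zero]
      have h1 : 0 < μ n := rate_pos hμ hμ1 (by omega)
      have h2 : 0 < μ (n + 1) := rate_pos hμ hμ1 (by omega)
      exact ⟨rfl, le_rfl, le_rfl, by simpa [arrivalTime] using hgap 0,
        by simpa using div_nonneg (hreq 1) h1.le, by simpa using div_nonneg (hreq 0) h2.le,
        by simp, by simp, by simp⟩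
    | succ N ih =>
      obtain ⟨k, l, t, hN, hdep, hah⟩ := ih
      have hσ := isReached_path (p := p) (mark := mark) hμ hμ1 hgap (fun k => hreq (k + 1)) n k
      have hτ := isReached_path (p := p) (mark := mark) hμ hμ1 hgap hreq (n + 1) l
      have hlK : l + 1 ≤ K := by
        by_contra! hlt
        have := monotone_path_dep (μ := μ) (p := p) (gap := gap) (req := req) (mark := mark)
          (n + 1) (Nat.lt_succ_iff.1 hlt)
        have := hah.dep_le
        simp only at *
        omega
      have htime := monotone_path_time (p := p) (mark := mark) hμ hμ1 hgap hreq (n + 1) hlK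
      rcases hah.next (p := p) (mark := mark) hμ hμ1 hp hgap hreq hσ hτ (by omega) with
        ⟨hd, ht, ha⟩ | ha | ⟨hd, ha⟩
      · simp only [← path_succ] at hd ht ha
        have hle : (path μ p n gap (fun k => req (k + 1)) mark (k + 1)).dep ≤ j := by
          by_contra! hlt
          exact (hcon _ hlt).not_ge (ht.trans htime)
        exact ⟨k + 1, l, _, by omega, hle, ha (by omega)⟩
      · rw [← path_succ] at ha
        exact ⟨k, l + 1, _, by omega, hdep, ha⟩
      · simp only [← path_succ] at hd ha
        exact ⟨k + 1, l + 1, _, by omega, by omega, ha⟩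
  -- Here `l < K`, and `k ≤ j + l` since the arrival counts agree; hence `k + l < 2 * K + j`.
  obtain ⟨k, l, t, hN, hdep, hah⟩ := key (2 * K + j + 1)
  have hσ := isReached_path (p := p) (mark := mark) hμ hμ1 hgap (fun k => hreq (k + 1)) n k
  have hτ := isReached_path (p := p) (mark := mark) hμ hμ1 hgap hreq (n + 1) l
  have hlK : l < K := by
    by_contra! hle
    have := monotone_path_dep (μ := μ) (p := p) (gap := gap) (req := req) (mark := mark)
      (n + 1) hle
    have := hah.dep_le
    simp only at *
    omega
  have h1 := hσ.count
  have h2 := hτ.count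
  have h3 := hah.arr_eq
  omega

/-- The sample path comparison of the two coupled systems. -/
lemma departureTime_le_departureTime (hμ : Monotone μ) (hμ1 : 0 < μ 1) (hp : Antitone p)
    (hgap : ∀ k, 0 ≤ gap k) (hreq : ∀ k, 0 ≤ req k) (harr : ∀ C, ∃ k, C < arrivalTime gap k)
    {n j : ℕ} (hjn : j < n) :
    departureTime μ p n gap (fun k => req (k + 1)) mark j ≤
      departureTime μ p (n + 1) gap req mark (j + 1) := by
  have hne := exists_lt_dep (p := p) (mark := mark) hμ hμ1 hgap hreq harr
    (show j + 1 < n + 1 by omega)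
  obtain ⟨k, hk, ht⟩ := exists_dep_time_le hμ hμ1 hp hgap hreq hjn (Nat.sInf_mem hne)
  exact (monotone_path_time (p := p) (mark := mark) hμ hμ1 hgap (fun k => hreq (k + 1)) n
    (Nat.sInf_le (s := {k | j < (path μ p n gap (fun k => req (k + 1)) mark k).dep}) hk)).trans ht

end Deterministic

end ThresholdQueue

namespace ThresholdQueue

/-! ### Measurability of departure times. -/

section Measurability

variable {Ω : Type*} [MeasurableSpace Ω]

lemma measurable_apply_nat {f : ℕ → Ω → ℝ} (hf : ∀ k, Measurable (f k)) {g : Ω → ℕ}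
    (hg : Measurable g) : Measurable fun ω => f (g ω) ω :=
  (measurable_from_prod_countable_right (f := fun q : ℕ × Ω => f q.1 q.2) hf).comp
    (hg.prodMk measurable_id)

/-- Measurability of a random state of the queue. -/
structure MeasurableState (σ : Ω → State) : Prop where
  time : Measurable fun ω => (σ ω).time
  num : Measurable fun ω => (σ ω).num
  rem : Measurable fun ω => (σ ω).rem
  dep : Measurable fun ω => (σ ω).dep
  arr : Measurable fun ω => (σ ω).arr

variable {μ p : ℕ → ℝ} {gap req mark : ℕ → Ω → ℝ}

lemma measurable_arrivalTime (hgap : ∀ k, Measurable (gap k)) (k : ℕ) :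
    Measurable fun ω => arrivalTime (fun k => gap k ω) k :=
  Finset.measurable_fun_sum _ fun i _ => hgap i

lemma MeasurableState.step (hgap : ∀ k, Measurable (gap k)) (hreq : ∀ k, Measurable (req k))
    (hmark : ∀ k, Measurable (mark k)) {σ : Ω → State} (h : MeasurableState σ) :
    MeasurableState fun ω =>
      step μ p (fun k => gap k ω) (fun k => req k ω) (fun k => mark k ω) (σ ω) := by
  classical
  obtain ⟨h1, h2, h3, h4, h5⟩ := h
  have harr : Measurable fun ω => arrivalTime (fun k => gap k ω) (σ ω).arr :=
    measurable_apply_nat (measurable_arrivalTime hgap) h5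
  have hrate : Measurable fun ω => μ (σ ω).num := (measurable_from_top (f := μ)).comp h2
  have hcomp : Measurable fun ω => (σ ω).time + (σ ω).rem / μ (σ ω).num := h1.add (h3.div hrate)
  have hpos : MeasurableSet {ω | 0 < (σ ω).num} := measurableSet_lt measurable_const h2
  have hset : MeasurableSet {ω | 0 < (σ ω).num ∧
      (σ ω).time + (σ ω).rem / μ (σ ω).num ≤ arrivalTime (fun k => gap k ω) (σ ω).arr} :=
    hpos.inter (measurableSet_le hcomp harr)
  have hjoin : MeasurableSet {ω | mark (σ ω).arr ω < p (σ ω).num} :=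
    measurableSet_lt (measurable_apply_nat hmark h5) ((measurable_from_top (f := p)).comp h2)
  constructor
  · simp only [ThresholdQueue.step, apply_ite State.time]
    exact Measurable.ite hset hcomp harr
  · simp only [ThresholdQueue.step, apply_ite State.num]
    exact Measurable.ite hset ((measurable_from_top (f := fun n : ℕ => n - 1)).comp h2)
      (Measurable.ite hjoin (h2.add_const 1) h2)
  · simp only [ThresholdQueue.step, apply_ite State.rem]
    exact Measurable.ite hset (measurable_apply_nat hreq (h4.add_const 1))
      (Measurable.ite hpos (h3.sub (hrate.mul (harr.sub h1))) h3)
  · simp only [ThresholdQueue.step, apply_ite State.dep]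
    exact Measurable.ite hset (h4.add_const 1) h4
  · simp only [ThresholdQueue.step, apply_ite State.arr]
    exact Measurable.ite hset h5 (h5.add_const 1)

lemma measurableState_path (hgap : ∀ k, Measurable (gap k)) (hreq : ∀ k, Measurable (req k))
    (hmark : ∀ k, Measurable (mark k)) (m k : ℕ) :
    MeasurableState fun ω =>
      path μ p m (fun k => gap k ω) (fun k => req k ω) (fun k => mark k ω) k := by
  induction k with
  | zero =>
    simp only [path_zero]
    exact ⟨measurable_const, measurable_const, hreq 0, measurable_const, measurable_const⟩
  | succ k ih =>
    simp only [path_succ]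
    exact ih.step hgap hreq hmark

lemma measurable_sInf_nat {s : Ω → Set ℕ} (hs : ∀ k, MeasurableSet {ω | k ∈ s ω}) :
    Measurable fun ω => sInf (s ω) := by
  refine measurable_of_Iic fun k => ?_
  -- The last set collects the `ω` with `s ω` empty, where the infimum defaults to `0`.
  have heq : (fun ω => sInf (s ω)) ⁻¹' Set.Iic k =
      (⋃ j ∈ Set.Iic k, {ω | j ∈ s ω}) ∪ ⋂ j, {ω | j ∈ s ω}ᶜ := by
    ext ω
    simp only [Set.mem_preimage, Set.mem_Iic, Set.mem_union, Set.mem_iUnion, Set.mem_iInter,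
      Set.mem_compl_iff, Set.mem_ofPred_eq, exists_prop]
    constructor
    · intro h
      rcases (s ω).eq_empty_or_nonempty with he | hne
      · right
        simp [he]
      · exact Or.inl ⟨_, h, Nat.sInf_mem hne⟩
    · rintro (⟨j, hj, hjs⟩ | h)
      · exact (Nat.sInf_le hjs).trans hj
      · simp [Set.eq_empty_of_forall_notMem h]
  rw [heq]
  exact (MeasurableSet.biUnion (Set.to_countable _) fun j _ => hs j).union
    (MeasurableSet.iInter fun j => (hs j).compl)

lemma measurable_departureTime (hgap : ∀ k, Measurable (gap k)) (hreq : ∀ k, Measurable (req k))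
    (hmark : ∀ k, Measurable (mark k)) (m i : ℕ) :
    Measurable fun ω =>
      departureTime μ p m (fun k => gap k ω) (fun k => req k ω) (fun k => mark k ω) i :=
  measurable_apply_nat (fun k => (measurableState_path hgap hreq hmark m k).time)
    (measurable_sInf_nat fun k =>
      measurableSet_lt measurable_const (measurableState_path hgap hreq hmark m k).dep)

end Measurability

/-! ### Positivity and mean of the exponential law. -/

section Exponential

lemma ae_pos_expMeasure {r : ℝ} (hr : 0 < r) : ∀ᵐ x ∂expMeasure r, 0 < x := by
  have := isProbabilityMeasure_expMeasure hr
  have h0 : expMeasure r (Set.Iic 0) = 0 := by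
    have h := cdf_expMeasure_eq hr 0
    rw [cdf_eq_real] at h
    simpa [measureReal_eq_zero_iff] using h
  rw [ae_iff]
  convert h0 using 2
  ext x
  simp

lemma integrable_id_expMeasure {r : ℝ} (hr : 0 < r) : Integrable (fun x => x) (expMeasure r) := by
  have hmeas : Measurable fun x => (exponentialPDFReal r x).toNNReal :=
    (measurable_exponentialPDFReal r).real_toNNReal
  have heq : expMeasure r =
      volume.withDensity fun x => ((exponentialPDFReal r x).toNNReal : ENNReal) := rfl
  rw [heq, integrable_withDensity_iff_integrable_smul hmeas]
  have hI : IntegrableOn (fun x : ℝ => r * (x ^ (1 : ℝ) * Real.exp (-r * x ^ (1 : ℝ))))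
      (Set.Ioi 0) :=
    (integrableOn_rpow_mul_exp_neg_mul_rpow (by norm_num) one_pos hr).const_mul r
  have hI' := (integrable_indicator_iff measurableSet_Ioi).2 hI
  refine hI'.congr (Filter.Eventually.of_forall fun x => ?_)
  rcases lt_trichotomy x 0 with hx | rfl | hx
  · simp [exponentialPDFReal, gammaPDFReal, hx.not_ge, hx.not_gt]
  · simp
  · have h1 : 0 ≤ r * Real.exp (-(r * x)) := by positivity
    simp [exponentialPDFReal, gammaPDFReal, hx, hx.le, NNReal.smul_def, Real.coe_toNNReal _ h1]
    ring

lemma integrable_of_hasLaw_expMeasure {Ω : Type*} [MeasurableSpace Ω] {P : Measure Ω} {r : ℝ}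
    (hr : 0 < r) {X : Ω → ℝ} (hX : HasLaw X (expMeasure r) P) : Integrable X P := by
  have hI := integrable_id_expMeasure hr
  rw [← hX.map_eq] at hI
  exact (integrable_map_measure hI.aestronglyMeasurable hX.aemeasurable).1 hI

lemma integral_id_expMeasure_pos {r : ℝ} (hr : 0 < r) : 0 < ∫ x, x ∂expMeasure r := by
  have := isProbabilityMeasure_expMeasure hr
  have hae := ae_pos_expMeasure hr
  rw [integral_pos_iff_support_of_nonneg_ae (hae.mono fun x hx => hx.le)
    (integrable_id_expMeasure hr)]
  refine pos_iff_ne_zero.2 fun h0 => ?_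
  have hne : ∀ᵐ x ∂expMeasure r, x = 0 := by
    rw [ae_iff]
    exact h0
  obtain ⟨x, hx, hx0⟩ := (hae.and hne).exists
  exact hx.ne' hx0

end Exponential

end ThresholdQueue

namespace ThresholdQueue

/-! ### Threshold strategies are non-increasing. -/

section Strategies

lemma antitone_pureThreshold (n₀ : ℕ) : Antitone (pureThreshold n₀) := by
  intro a b hab
  simp only [pureThreshold]
  split_ifs <;> first | omega | norm_num

lemma antitone_mixedThreshold {x : ℝ} (hx : 0 < x) : Antitone (mixedThreshold x) := by
  intro a b hab
  have h1 : (⌊x⌋₊ : ℝ) ≤ x := Nat.floor_le hx.le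
  have h2 : x < ⌊x⌋₊ + 1 := Nat.lt_floor_add_one x
  simp only [mixedThreshold]
  split_ifs <;> first | omega | linarith

lemma IsThresholdStrategy.antitone {p : ℕ → ℝ} (hp : IsThresholdStrategy p) : Antitone p := by
  rcases hp with ⟨n₀, -, rfl⟩ | ⟨x, hx, rfl⟩
  · exact antitone_pureThreshold n₀
  · exact antitone_mixedThreshold hx

end Strategies

/-! ### From sample paths to expectations. -/

section Driving

instance : Countable Source := by
  let f : Source → ℕ × ℕ
    | .gap k => (0, k)
    | .req k => (1, k)
    | .mark k => (2, k)
  refine Function.Injective.countable (f := f) ?_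
  rintro (a | a | a) (b | b | b) h <;> simp_all [f]

lemma isProbabilityMeasure_sourceLaw {lam : ℝ} (hlam : 0 < lam) (s : Source) :
    IsProbabilityMeasure (sourceLaw lam s) := by
  cases s with
  | gap k => exact isProbabilityMeasure_expMeasure hlam
  | req k => exact isProbabilityMeasure_expMeasure one_pos
  | mark k => exact ⟨by simp [sourceLaw]⟩

lemma isDriving_infinitePi {lam : ℝ} (hlam : 0 < lam) :
    IsDriving lam (fun s (ω : Source → ℝ) => ω s) (Measure.infinitePi (sourceLaw lam)) := by
  have := isProbabilityMeasure_sourceLaw hlam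
  exact ⟨iIndepFun_infinitePi (X := fun _ x => x) fun _ => measurable_id,
    fun s => (measurePreserving_eval_infinitePi (sourceLaw lam) s).hasLaw⟩

variable {Ω : Type*} [MeasurableSpace Ω] {P : Measure Ω} {lam : ℝ} {ξ : Source → Ω → ℝ}
  {μ p : ℕ → ℝ}

/-- The departure time of customer `i` of the queue with `m` initial customers, driven by `ω`. -/
noncomputable def drivenDeparture (μ p : ℕ → ℝ) (m i : ℕ) (ω : Source → ℝ) : ℝ :=
  departureTime μ p m (fun k => ω (.gap k)) (fun k => ω (.req k)) (fun k => ω (.mark k)) i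

lemma measurable_drivenDeparture (m i : ℕ) : Measurable (drivenDeparture μ p m i) :=
  measurable_departureTime (gap := fun k (ω : Source → ℝ) => ω (.gap k))
    (req := fun k ω => ω (.req k)) (mark := fun k ω => ω (.mark k)) (fun _ => measurable_pi_apply _)
    (fun _ => measurable_pi_apply _) (fun _ => measurable_pi_apply _) m i

lemma IsDriving.ae_gap_pos (h : IsDriving lam ξ P) (hlam : 0 < lam) :
    ∀ᵐ ω ∂P, ∀ k, 0 < ξ (.gap k) ω :=
  ae_all_iff.2 fun k => ((h.law (.gap k)).ae_iff (measurableSet_setOfPred.1 measurableSet_Ioi)).2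
    (ae_pos_expMeasure hlam)

lemma IsDriving.ae_req_pos (h : IsDriving lam ξ P) : ∀ᵐ ω ∂P, ∀ k, 0 < ξ (.req k) ω :=
  ae_all_iff.2 fun k => ((h.law (.req k)).ae_iff (measurableSet_setOfPred.1 measurableSet_Ioi)).2
    (ae_pos_expMeasure one_pos)

lemma IsDriving.integrable_req (h : IsDriving lam ξ P) (k : ℕ) : Integrable (ξ (.req k)) P :=
  integrable_of_hasLaw_expMeasure one_pos (h.law (.req k))

/-- Almost surely, the arrival times are unbounded. -/
lemma IsDriving.ae_arrivalTime_unbounded [IsProbabilityMeasure P] (h : IsDriving lam ξ P)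
    (hlam : 0 < lam) : ∀ᵐ ω ∂P, ∀ C, ∃ k, C < arrivalTime (fun k => ξ (.gap k) ω) k := by
  have hlaw : ∀ k, HasLaw (ξ (.gap k)) (expMeasure lam) P := fun k => h.law (.gap k)
  have hint : Integrable (ξ (.gap 0)) P := integrable_of_hasLaw_expMeasure hlam (hlaw 0)
  have hmean : 0 < ∫ ω, ξ (.gap 0) ω ∂P := by
    have hI := integral_id_expMeasure_pos hlam
    rwa [← (hlaw 0).map_eq, integral_map (f := fun x => x) (hlaw 0).aemeasurable
      measurable_id.aestronglyMeasurable] at hI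
  have hslln := strong_law_ae_real (fun k => ξ (.gap k)) hint
    (fun i j hij => h.indep.indepFun (by simpa using hij))
    (fun i => ⟨(hlaw i).aemeasurable, (hlaw 0).aemeasurable,
      (hlaw i).map_eq.trans (hlaw 0).map_eq.symm⟩)
  filter_upwards [hslln] with ω hω C
  -- The averages converge to a positive mean, so the partial sums diverge.
  have htop := hω.pos_mul_atTop hmean tendsto_natCast_atTop_atTop
  obtain ⟨N, hN, hN0⟩ :=
    ((htop.eventually_gt_atTop C).and (Filter.eventually_gt_atTop 0)).exists
  -- Arrival `k` is the sum of `k + 1` gaps.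
  obtain ⟨k, rfl⟩ := Nat.exists_eq_succ_of_ne_zero (ne_of_gt hN0)
  refine ⟨k, ?_⟩
  rwa [div_mul_cancel₀ _ (by positivity)] at hN

/-- Relabelling the customers by removing the first service requirement. -/
def dropReq : Source → Source
  | .gap k => .gap k
  | .req k => .req (k + 1)
  | .mark k => .mark k

/-- The relabelling is injective and preserves the type of each source; it makes system A an
ordinary queue with the prescribed law. -/
lemma IsDriving.dropReq (h : IsDriving lam ξ P) :
    IsDriving lam (fun s => ξ (dropReq s)) P := by
  refine ⟨h.indep.precomp (g := ThresholdQueue.dropReq) ?_, fun s => ?_⟩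
  · rintro (a | a | a) (b | b | b) hab <;> simp_all [ThresholdQueue.dropReq]
  · cases s with
    | gap k => exact h.law (.gap k)
    | req k => exact h.law (.req (k + 1))
    | mark k => exact h.law (.mark k)

/-- Independence and the marginals determine the joint law, so expectations can be computed on the
canonical product space. -/
lemma IsDriving.hasLaw [IsProbabilityMeasure P] (h : IsDriving lam ξ P) :
    HasLaw (fun ω s => ξ s ω) (Measure.infinitePi (sourceLaw lam)) P :=
  h.indep.hasLaw_infinitePi h.law (aemeasurable_pi_iff.2 fun s => (h.law s).aemeasurable)

lemma IsDriving.integral_departure [IsProbabilityMeasure P] (h : IsDriving lam ξ P) (m i : ℕ) :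
    ∫ ω, drivenDeparture μ p m i (fun s => ξ s ω) ∂P = genWait lam μ p i m := by
  rw [← integral_map h.hasLaw.aemeasurable
    (measurable_drivenDeparture m i).aestronglyMeasurable, h.hasLaw.map_eq]
  rfl

lemma IsDriving.integrable_departure [IsProbabilityMeasure P] (h : IsDriving lam ξ P)
    (hlam : 0 < lam) (hμ : Monotone μ) (hμ1 : 0 < μ 1) {m i : ℕ} (hi : i < m) :
    Integrable (fun ω => drivenDeparture μ p m i (fun s => ξ s ω)) P := by
  have hbound : Integrable
      (fun ω => (∑ j ∈ Finset.range (i + 1), ξ (.req j) ω) / μ 1) P :=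
    (integrable_finsetSum _ fun j _ => h.integrable_req j).div_const _
  refine hbound.mono' ((measurable_drivenDeparture m i).comp_aemeasurable
    h.hasLaw.aemeasurable).aestronglyMeasurable ?_
  filter_upwards [h.ae_gap_pos hlam, h.ae_req_pos] with ω hgap hreq
  have hmem := departureTime_mem_Icc (p := p) (mark := fun k => ξ (.mark k) ω) hμ hμ1
    (fun k => (hgap k).le) (fun k => (hreq k).le) hi
  rw [Real.norm_of_nonneg (by exact hmem.1)]
  exact hmem.2

lemma IsDriving.ae_sojournA_le [IsProbabilityMeasure P] (h : IsDriving lam ξ P)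
    (hlam : 0 < lam) (hμ : Monotone μ) (hμ1 : 0 < μ 1) (hp : Antitone p) (n : ℕ) :
    ∀ᵐ ω ∂P, ∀ j, 1 ≤ j → j ≤ n → sojournA μ p n ξ j ω ≤ sojournB μ p n ξ j ω := by
  filter_upwards [h.ae_gap_pos hlam, h.ae_req_pos, h.ae_arrivalTime_unbounded hlam] with
    ω hgap hreq harr j hj hjn
  -- Customer `i + 1` is served in position `i` in A and in position `i + 1` in B.
  obtain ⟨i, rfl⟩ := Nat.exists_eq_add_of_le' hj
  exact departureTime_le_departureTime (req := fun k => ξ (.req k) ω) hμ hμ1 hp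
    (fun k => (hgap k).le) (fun k => (hreq k).le) harr hjn

/-- The coupling of the two systems, together with the laws of its marginals. -/
lemma IsDriving.coupling [IsProbabilityMeasure P] (h : IsDriving lam ξ P)
    (hlam : 0 < lam) (hμ : Monotone μ) (hμ1 : 0 < μ 1) (hp : Antitone p) {n : ℕ} (hn : 1 ≤ n) :
    (∀ᵐ ω ∂P, ∀ j, 1 ≤ j → j ≤ n → sojournA μ p n ξ j ω ≤ sojournB μ p n ξ j ω) ∧
      Integrable (sojournA μ p n ξ n) P ∧
      ∫ ω, sojournA μ p n ξ n ω ∂P = genWait lam μ p (n - 1) n ∧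
      Integrable (sojournB μ p n ξ n) P ∧
      ∫ ω, sojournB μ p n ξ n ω ∂P = genWait lam μ p n (n + 1) :=
  ⟨h.ae_sojournA_le hlam hμ hμ1 hp n,
    h.dropReq.integrable_departure hlam hμ hμ1 (by omega),
    h.dropReq.integral_departure n (n - 1),
    h.integrable_departure hlam hμ hμ1 (by omega),
    h.integral_departure (n + 1) n⟩

lemma genWait_le_genWait (hlam : 0 < lam) (hμ : Monotone μ) (hμ1 : 0 < μ 1) (hp : Antitone p)
    {n : ℕ} (hn : 1 ≤ n) : genWait lam μ p (n - 1) n ≤ genWait lam μ p n (n + 1) := by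
  have := isProbabilityMeasure_sourceLaw hlam
  obtain ⟨hle, hA, hAe, hB, hBe⟩ := (isDriving_infinitePi hlam).coupling hlam hμ hμ1 hp hn
  rw [← hAe, ← hBe]
  exact integral_mono_ae hA hB (hle.mono fun ω hω => hω n hn le_rfl)

lemma monotoneOn_delay (hlam : 0 < lam) (hμ : Monotone μ) (hμ1 : 0 < μ 1) (hp : Antitone p) :
    MonotoneOn (delay lam μ p) (Set.Iic (balkState p)) := by
  have hmono : Monotone fun n => genWait lam μ p n (n + 1) :=
    monotone_nat_of_le_succ fun n => by
      simpa using genWait_le_genWait hlam hμ hμ1 hp (Nat.le_add_left 1 n)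
  intro a ha b hb hab
  simp only [Set.mem_Iic] at ha hb
  rcases hab.eq_or_lt with rfl | hlt
  · exact le_rfl
  have ha' : a < balkState p := by omega
  rw [delay, delay, if_pos ha']
  split_ifs with hb'
  · exact hmono hab
  -- At the balking state the delay exceeds the one just below it by the nonnegative term `1 / μ
  -- (balkState p + 1)`.
  · have h1 : a ≤ balkState p - 1 := by omega
    have h2 := hmono h1
    simp only [Nat.sub_add_cancel (show 1 ≤ balkState p by omega)] at h2
    have h3 : 0 ≤ 1 / μ (balkState p + 1) :=
      one_div_nonneg.2 (rate_pos hμ hμ1 (Nat.succ_pos _)).le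
    linarith

end Driving

end ThresholdQueue

theorem proposition1 (lam : ℝ) (hlam : 0 < lam) (μ : ℕ → ℝ) (hμ : Monotone μ) (hμ1 : 0 < μ 1)
    (p : ℕ → ℝ) (hp : ThresholdQueue.IsThresholdStrategy p) :
    (∀ (Ω : Type*) [MeasurableSpace Ω] (P : Measure Ω) [IsProbabilityMeasure P]
      (ξ : ThresholdQueue.Source → Ω → ℝ), ThresholdQueue.IsDriving lam ξ P →
      ∀ n : ℕ, 1 ≤ n →
        (∀ᵐ ω ∂P, ∀ j : ℕ, 1 ≤ j → j ≤ n →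
          ThresholdQueue.sojournA μ p n ξ j ω ≤ ThresholdQueue.sojournB μ p n ξ j ω) ∧
        Integrable (ThresholdQueue.sojournA μ p n ξ n) P ∧
        ∫ ω, ThresholdQueue.sojournA μ p n ξ n ω ∂P = ThresholdQueue.genWait lam μ p (n - 1) n ∧
        Integrable (ThresholdQueue.sojournB μ p n ξ n) P ∧
        ∫ ω, ThresholdQueue.sojournB μ p n ξ n ω ∂P = ThresholdQueue.genWait lam μ p n (n + 1)) ∧
    (∀ n : ℕ, 1 ≤ n →
      ThresholdQueue.genWait lam μ p (n - 1) n ≤ ThresholdQueue.genWait lam μ p n (n + 1)) ∧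
    MonotoneOn (ThresholdQueue.delay lam μ p) (Set.Iic (ThresholdQueue.balkState p)) := by
  have hanti := hp.antitone
  exact ⟨fun Ω _ P _ ξ hξ n hn => hξ.coupling hlam hμ hμ1 hanti hn,
    fun n hn => ThresholdQueue.genWait_le_genWait hlam hμ hμ1 hanti hn,
    ThresholdQueue.monotoneOn_delay hlam hμ hμ1 hanti⟩
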